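/- Let $\Lambda$ be an artin algebra, i.e. an algebra over a commutative artinian ring $R$ that is finitely generated as an $R$-module, and suppose that $\Lambda$ is (Iwanaga-)Gorenstein, i.e. $\Lambda$ has finite injective dimension both as a right and as a left module over itself. Let $\mathrm{mod}\text{-}\Lambda$ be the category of finitely generated right $\Lambda$-modules and let $n\ge 1$. For a full subcategory $\mathcal X\subseteq \mathrm{mod}\text{-}\Lambda$ put $$\mathcal X^{\perp_n}=\{X\in\mathrm{mod}\text{-}\Lambda \mid \mathrm{Ext}^i_\Lambda(\mathcal X,X)=0 \text{ for all } 0<i<n\},\qquad {}^{\perp_n}\mathcal X=\{X\in\mathrm{mod}\text{-}\Lambda \mid \mathrm{Ext}^i_\Lambda(X,\mathcal X)=0 \text{ for all } 0<i<n\}.$$ Let $\mathcal C$ be an $n\mathbb Z$-cluster tilting subcategory of $\mathrm{mod}\text{-}\Lambda$, i.e. $\mathcal C$ is functorially finite in $\mathrm{mod}\text{-}\Lambda$, $\mathcal C=\mathcal C^{\perp_n}={}^{\perp_n}\mathcal C$, and $\mathrm{Ext}^i_\Lambda(\mathcal C,\mathcal C)=0$ for all $i\notin n\mathbb Z$. For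 a complex $\mathbf P:\cdots\to P^{-1}\to P^0\to P^1\to\cdots$ let $Z^j=\mathrm{Ker}(P^j\to P^{j+1})$. Let $\mathrm{Gprj}\text{-}\Lambda$ be the subcategory of finitely generated Gorenstein projective right modules, i.e. of those modules isomorphic to some $Z^j$ of an acyclic complex $\mathbf P$ of finitely generated projective right modules such that $\mathrm{Hom}_\Lambda(\mathbf P,Q)$ is acyclic for every projective module $Q$. Let $n\mathbb Z\text{-}\mathrm{Gprj}\,\mathcal C$ be the subcategory of those modules in $\mathcal C$ that are isomorphic to $Z^{in}$ for some $i\in\mathbb Z$ and some acyclic complex $\mathbf P$ of finitely generated projective right modules such that $Z^{in}\in\mathcal C$ for all $i\in\mathbb Z$ and such that, for all $i\in\mathbb Z$ and every projective module $Q$, applying $\mathrm{Hom}_\Lambda(-,Q)$ to the exact sequence $$0\to Z^{in}\to P^{in}\to P^{in+1}\to\cdots\to P^{(i+1)n-1}\to Z^{(i+1)n}\to 0$$ gives an acyclic complex. Then $$n\mathbb Z\text{-}\mathrm{Gprj}\,\mathcal C={}^{\perp_n}(n\mathbb Z\text{-}\mathrm{Gprj}\,\mathcal C)\cap \mathrm{Gprj}\text{-}\Lambda=(n\mathbb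 Z\text{-}\mathrm{Gprj}\,\mathcal C)^{\perp_n}\cap \mathrm{Gprj}\text{-}\Lambda .$$ -/

import Mathlib

universe u

namespace NZGor

open CategoryTheory

/-- The category of all right `Λ`-modules. -/
abbrev ModR (Λ : Type u) [Ring Λ] := ModuleCat.{u} Λᵐᵒᵖ

/-- `mod-Λ`: the finitely generated right `Λ`-modules. -/
def fgMod (Λ : Type u) [Ring Λ] : ObjectProperty (ModR Λ) :=
  fun M => Module.Finite Λᵐᵒᵖ M

/-- `Λ` is an artin algebra over the commutative artinian ring `R`. -/
def IsArtinAlgebra (R : Type*) [CommRing R] (Λ : Type u) [Ring Λ] [Algebra R Λ] : Prop :=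
  IsArtinianRing R ∧ Module.Finite R Λ

/-- `Λ` is Iwanaga-Gorenstein: finite injective dimension both as a right and as a left module
over itself. -/
def IsIwanagaGorenstein (Λ : Type u) [Ring Λ] : Prop :=
  (∃ d : ℕ, HasInjectiveDimensionLE (ModuleCat.of Λᵐᵒᵖ Λ) d) ∧
    (∃ d : ℕ, HasInjectiveDimensionLE (ModuleCat.of Λ Λ) d)

section Perp

variable {Λ : Type u} [Ring Λ]

/-- `𝒳^{⊥ₙ}`, as a full subcategory of `mod-Λ`. -/
def rightPerp (n : ℕ) (𝒳 : ObjectProperty (ModR Λ)) : ObjectProperty (ModR Λ) :=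
  fun X => fgMod Λ X ∧
    ∀ C : ModR Λ, 𝒳 C → ∀ i : ℕ, 0 < i → i < n → Subsingleton (Abelian.Ext C X i)

/-- `^{⊥ₙ}𝒳`, as a full subcategory of `mod-Λ`. -/
def leftPerp (n : ℕ) (𝒳 : ObjectProperty (ModR Λ)) : ObjectProperty (ModR Λ) :=
  fun X => fgMod Λ X ∧
    ∀ C : ModR Λ, 𝒳 C → ∀ i : ℕ, 0 < i → i < n → Subsingleton (Abelian.Ext X C i)

/-- Every module in `mod-Λ` has a right `𝒞`-approximation. -/
def IsContravariantlyFinite (𝒞 : ObjectProperty (ModR Λ)) : Prop :=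
  ∀ M : ModR Λ, fgMod Λ M → ∃ (C : ModR Λ) (f : C ⟶ M), 𝒞 C ∧
    ∀ (C' : ModR Λ) (g : C' ⟶ M), 𝒞 C' → ∃ h : C' ⟶ C, h ≫ f = g

/-- Every module in `mod-Λ` has a left `𝒞`-approximation. -/
def IsCovariantlyFinite (𝒞 : ObjectProperty (ModR Λ)) : Prop :=
  ∀ M : ModR Λ, fgMod Λ M → ∃ (C : ModR Λ) (f : M ⟶ C), 𝒞 C ∧
    ∀ (C' : ModR Λ) (g : M ⟶ C'), 𝒞 C' → ∃ h : C ⟶ C', f ≫ h = g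

/-- `𝒞` is an `n`-cluster tilting subcategory of `mod-Λ`. (That `𝒞` is contained in `mod-Λ` and
closed under isomorphisms follows from the two equalities.) -/
structure IsClusterTilting (n : ℕ) (𝒞 : ObjectProperty (ModR Λ)) : Prop where
  contravariantlyFinite : IsContravariantlyFinite 𝒞
  covariantlyFinite : IsCovariantlyFinite 𝒞
  eq_rightPerp : 𝒞 = rightPerp n 𝒞
  eq_leftPerp : 𝒞 = leftPerp n 𝒞

/-- `𝒞` is an `nℤ`-cluster tilting subcategory of `mod-Λ`: it is `n`-cluster tilting and
`Ext^i(𝒞, 𝒞) = 0` for all `i ∉ nℤ`. -/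
structure IsNZClusterTilting (n : ℕ) (𝒞 : ObjectProperty (ModR Λ)) : Prop
    extends IsClusterTilting n 𝒞 where
  ext_eq_zero : ∀ X Y : ModR Λ, 𝒞 X → 𝒞 Y → ∀ i : ℕ, ¬ n ∣ i → Subsingleton (Abelian.Ext X Y i)

end Perp

section Gorenstein

variable {Λ : Type u} [Ring Λ]

/-- `P` is an acyclic complex of finitely generated projective right modules
(with differentials `P^j ⟶ P^(j+1)`). -/
structure IsAcyclicFGProj (P : CochainComplex (ModR Λ) ℤ) : Prop where
  acyclic : P.Acyclic
  finite : ∀ j, Module.Finite Λᵐᵒᵖ (P.X j)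
  projective : ∀ j, Module.Projective Λᵐᵒᵖ (P.X j)

/-- Totally acyclic complex of finitely generated projectives: moreover `Hom(P, Q)` is acyclic
for every projective module `Q`. -/
structure IsTotallyAcyclic (P : CochainComplex (ModR Λ) ℤ) : Prop extends IsAcyclicFGProj P where
  hom_acyclic : ∀ Q : ModR Λ, Module.Projective Λᵐᵒᵖ Q → ∀ (j : ℤ) (g : P.X j ⟶ Q),
    P.d (j - 1) j ≫ g = 0 → ∃ h : P.X (j + 1) ⟶ Q, P.d j (j + 1) ≫ h = g

/-- `Gprj-Λ`: the finitely generated Gorenstein projective right modules. Here `P.cycles j` is the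
kernel `Z^j` of `P^j ⟶ P^(j+1)`. -/
def Gprj (Λ : Type u) [Ring Λ] : ObjectProperty (ModR Λ) :=
  fun G => ∃ P : CochainComplex (ModR Λ) ℤ, IsTotallyAcyclic P ∧
    ∃ j : ℤ, Nonempty (G ≅ P.cycles j)

/-- Acyclicity of `Hom(S, Q)`, where `S` is the sequence
`0 ⟶ Z^a ⟶ P^a ⟶ P^(a+1) ⟶ ⋯ ⟶ P^(b-1) ⟶ Z^b ⟶ 0` (for `a < b`) cut out of the complex `P`.
The maps `Z^a ⟶ P^a` and `P^(b-1) ⟶ Z^b` are `P.iCycles a` and `P.toCycles (b-1) b`. -/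
structure HomSegmentAcyclic (P : CochainComplex (ModR Λ) ℤ) (a b : ℤ) (Q : ModR Λ) : Prop where
  /-- exactness at `Hom(Z^b, Q)` -/
  exact_right : ∀ h : P.cycles b ⟶ Q, P.toCycles (b - 1) b ≫ h = 0 → h = 0
  /-- exactness at `Hom(P^j, Q)` for `a ≤ j < b`; the neighbours of `P^j` in `S` are `Z^a` on the
  left if `j = a`, and `Z^b` on the right if `j = b - 1` -/
  exact_middle : ∀ (j : ℤ), a ≤ j → j < b → ∀ g : P.X j ⟶ Q,
    (j = a → P.iCycles j ≫ g = 0) → (a < j → P.d (j - 1) j ≫ g = 0) →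
      (j = b - 1 → ∃ h : P.cycles (j + 1) ⟶ Q, P.toCycles j (j + 1) ≫ h = g) ∧
      (j < b - 1 → ∃ h : P.X (j + 1) ⟶ Q, P.d j (j + 1) ≫ h = g)
  /-- exactness at `Hom(Z^a, Q)` -/
  exact_left : ∀ f : P.cycles a ⟶ Q, ∃ g : P.X a ⟶ Q, P.iCycles a ≫ g = f

/-- `nℤ`-totally acyclic complexes (relative to `𝒞`). -/
structure IsNZTotallyAcyclic (n : ℕ) (𝒞 : ObjectProperty (ModR Λ))
    (P : CochainComplex (ModR Λ) ℤ) : Prop extends IsAcyclicFGProj P where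
  hom_acyclic : ∀ Q : ModR Λ, Module.Projective Λᵐᵒᵖ Q → ∀ i : ℤ,
    HomSegmentAcyclic P (i * n) ((i + 1) * n) Q
  cycles_mem : ∀ i : ℤ, 𝒞 (P.cycles (i * n))

/-- `nℤ-Gprj 𝒞`: the `nℤ`-Gorenstein projective modules in `𝒞`. -/
def nzGprj (n : ℕ) (𝒞 : ObjectProperty (ModR Λ)) : ObjectProperty (ModR Λ) :=
  fun G => 𝒞 G ∧ ∃ P : CochainComplex (ModR Λ) ℤ, IsNZTotallyAcyclic n 𝒞 P ∧
    ∃ i : ℤ, Nonempty (G ≅ P.cycles (i * n))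

end Gorenstein

end NZGor

-- Over a noetherian Iwanaga-Gorenstein ring, a finitely generated M is Gorenstein projective iff
-- Ext^i(M, Q) = 0 for all i > 0 and all projective Q (`Gprj_eq_semiGorensteinProjective`); the
-- required cosyzygies come from the duality Hom(-, Λ). As 𝒞 is closed under kn-th syzygies and
-- Gorenstein projective kn-th cosyzygies, a complete resolution of a Gorenstein projective module
-- in 𝒞 has every Z^{in} in 𝒞. So nℤ-Gprj 𝒞 is 𝒟 = 𝒞 ∩ Gprj (`nzGprj_eq`), and rigidity of 𝒞 gives
-- the easy inclusions.
--
-- Left orthogonal (`IsNZClusterTilting.mem_of_leftPerp`): let X be Gorenstein projective with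
-- Ext^i(X, 𝒟) = 0 for 0 < i < n. For C in 𝒞, take the dn-th syzygy, where d bounds the right
-- injective dimension of Λ, and go back up by dn Gorenstein projective cosyzygies. The result Y
-- lies in 𝒟. Since X has no higher extensions with projectives, Ext^i(X, C) vanishes iff Ext^i(X,
-- Y) does, so X lies in 𝒞.
--
-- Right orthogonal (`IsNZClusterTilting.mem_of_rightPerp`): this shift is not available in the
-- first argument. Instead a left 𝒞-approximation gives 0 → X → D → X' → 0 with D in 𝒟 and X'
-- Gorenstein projective. Iterating on cokernels embeds Ext^1(X', X) into Ext^{n-1}(X^{(n-1)}, X),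
-- where X^{(n-1)} is left orthogonal to 𝒟 and hence in 𝒟 by the first half. So Ext^1(X', X) = 0,
-- the sequence splits, and X is a summand of D.

universe v w

namespace NZGor

open CategoryTheory Abelian

/-! ### Vanishing of Ext along short exact sequences -/

section ExtVanishing

variable {C : Type u} [Category.{v} C] [Abelian C] [HasExt.{w} C]
  {S : ShortComplex C} (hS : S.ShortExact)

include hS

/-- The contravariant long exact sequence at `Ext^n(X₁, Y)`. -/
lemma subsingleton_ext_X₁_left {Y : C} {n : ℕ} (h₂ : Subsingleton (Ext S.X₂ Y n))
    (h₃ : Subsingleton (Ext S.X₃ Y (n + 1))) : Subsingleton (Ext S.X₁ Y n) := by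
  refine subsingleton_of_forall_eq 0 fun x => ?_
  obtain ⟨y, rfl⟩ := Ext.contravariant_sequence_exact₁ hS Y x (add_comm 1 n)
    (Subsingleton.elim _ _)
  rw [Subsingleton.elim y 0, Ext.comp_zero]

/-- The contravariant long exact sequence at `Ext^(n+1)(X₃, Y)`. -/
lemma subsingleton_ext_X₃_left {Y : C} {n : ℕ} (h₁ : Subsingleton (Ext S.X₁ Y n))
    (h₂ : Subsingleton (Ext S.X₂ Y (n + 1))) : Subsingleton (Ext S.X₃ Y (n + 1)) := by
  refine subsingleton_of_forall_eq 0 fun x => ?_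
  obtain ⟨y, rfl⟩ := Ext.contravariant_sequence_exact₃ hS Y x (Subsingleton.elim _ _)
    (add_comm 1 n)
  rw [Subsingleton.elim y 0, Ext.comp_zero]

/-- The contravariant long exact sequence at `Ext^n(X₂, Y)`. -/
lemma subsingleton_ext_X₂_left {Y : C} {n : ℕ} (h₁ : Subsingleton (Ext S.X₁ Y n))
    (h₃ : Subsingleton (Ext S.X₃ Y n)) : Subsingleton (Ext S.X₂ Y n) := by
  refine subsingleton_of_forall_eq 0 fun x => ?_
  obtain ⟨y, rfl⟩ := Ext.contravariant_sequence_exact₂ hS Y x (Subsingleton.elim _ _)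
  rw [Subsingleton.elim y 0, Ext.comp_zero]

/-- The covariant long exact sequence at `Ext^n(X, X₃)`. -/
lemma subsingleton_ext_X₃_right {X : C} {n : ℕ} (h₂ : Subsingleton (Ext X S.X₂ n))
    (h₁ : Subsingleton (Ext X S.X₁ (n + 1))) : Subsingleton (Ext X S.X₃ n) := by
  refine subsingleton_of_forall_eq 0 fun x => ?_
  obtain ⟨y, rfl⟩ := Ext.covariant_sequence_exact₃ X hS x rfl (Subsingleton.elim _ _)
  rw [Subsingleton.elim y 0, Ext.zero_comp]

/-- The covariant long exact sequence at `Ext^(n+1)(X, X₁)`. -/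
lemma subsingleton_ext_X₁_right {X : C} {n : ℕ} (h₃ : Subsingleton (Ext X S.X₃ n))
    (h₂ : Subsingleton (Ext X S.X₂ (n + 1))) : Subsingleton (Ext X S.X₁ (n + 1)) := by
  refine subsingleton_of_forall_eq 0 fun x => ?_
  obtain ⟨y, rfl⟩ := Ext.covariant_sequence_exact₁ X hS x (Subsingleton.elim _ _) rfl
  rw [Subsingleton.elim y 0, Ext.zero_comp]

lemma exists_extension_of_subsingleton_ext {Y : C} (h : Subsingleton (Ext S.X₃ Y 1))
    (f : S.X₁ ⟶ Y) : ∃ g : S.X₂ ⟶ Y, S.f ≫ g = f := by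
  obtain ⟨y, hy⟩ := Ext.contravariant_sequence_exact₁ hS Y (Ext.mk₀ f) (add_comm 1 0)
    (Subsingleton.elim _ _)
  obtain ⟨g, rfl⟩ := (Ext.mk₀_bijective _ _).2 y
  exact ⟨g, (Ext.mk₀_bijective _ _).1 (by simpa using hy)⟩

lemma subsingleton_ext_one_of_exists_extension {Y : C} (h₂ : Subsingleton (Ext S.X₂ Y 1))
    (h : ∀ f : S.X₁ ⟶ Y, ∃ g : S.X₂ ⟶ Y, S.f ≫ g = f) : Subsingleton (Ext S.X₃ Y 1) := by
  refine subsingleton_of_forall_eq 0 fun x => ?_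
  obtain ⟨y, rfl⟩ := Ext.contravariant_sequence_exact₃ hS Y x (Subsingleton.elim _ _)
    (add_comm 1 0)
  obtain ⟨f, rfl⟩ := (Ext.mk₀_bijective _ _).2 y
  obtain ⟨g, rfl⟩ := h f
  rw [← Ext.mk₀_comp_mk₀, hS.extClass_comp_assoc]

end ExtVanishing

section Retract

variable {C : Type u} [Category.{v} C] [Abelian C] [HasExt.{w} C]

lemma subsingleton_ext_of_retract_left {X X' Y : C} (i : X ⟶ X') (r : X' ⟶ X) (h : i ≫ r = 𝟙 X)
    {n : ℕ} (h' : Subsingleton (Ext X' Y n)) : Subsingleton (Ext X Y n) := by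
  refine subsingleton_of_forall_eq 0 fun x => ?_
  have : x = (Ext.mk₀ i).comp ((Ext.mk₀ r).comp x (zero_add n)) (zero_add n) := by
    rw [Ext.mk₀_comp_mk₀_assoc, h, Ext.mk₀_id_comp]
  rw [this, Subsingleton.elim ((Ext.mk₀ r).comp x (zero_add n)) 0, Ext.comp_zero]

end Retract

/-! ### Syzygies and dimension shifting -/

section Syzygies

variable {T : Type u} [Ring T]

lemma subsingleton_ext_of_module_projective (P Y : ModuleCat.{u} T) (hP : Module.Projective T P)
    {i : ℕ} (hi : 0 < i) : Subsingleton (Ext P Y i) := by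
  obtain ⟨j, rfl⟩ := Nat.exists_eq_succ_of_ne_zero hi.ne'
  exact Ext.subsingleton_of_projective P Y j

/-- Finitely generated modules `M` with `Ext^i(M, Q) = 0` for all `i > 0` and all projective
modules `Q`. -/
def semiGorensteinProjective (T : Type u) [Ring T] : ObjectProperty (ModuleCat.{u} T) :=
  fun M => Module.Finite T M ∧ ∀ Q : ModuleCat.{u} T, Module.Projective T Q → ∀ i : ℕ, 0 < i →
    Subsingleton (Ext M Q i)

/-- `A` is a first syzygy of `B`, with respect to a finitely generated projective module. -/
def IsSyzygyStep (A B : ModuleCat.{u} T) : Prop :=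
  ∃ (P : ModuleCat.{u} T) (f : A ⟶ P) (g : P ⟶ B) (w : f ≫ g = 0),
    (ShortComplex.mk f g w).ShortExact ∧ Module.Finite T P ∧ Module.Projective T P

/-- `A` is an `m`-th syzygy of `B`. -/
def IsSyzygy : ℕ → ModuleCat.{u} T → ModuleCat.{u} T → Prop
  | 0, A, B => A = B
  | m + 1, A, B => ∃ M, IsSyzygy m A M ∧ IsSyzygyStep M B

variable {A B X : ModuleCat.{u} T}

lemma IsSyzygyStep.subsingleton_ext_left_iff (h : IsSyzygyStep A B) (Y : ModuleCat.{u} T) {i : ℕ}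
    (hi : 0 < i) : Subsingleton (Ext A Y i) ↔ Subsingleton (Ext B Y (i + 1)) := by
  obtain ⟨P, f, g, w, hS, -, hP⟩ := h
  exact ⟨fun h => subsingleton_ext_X₃_left hS h
      (subsingleton_ext_of_module_projective P Y hP i.succ_pos),
    fun h => subsingleton_ext_X₁_left hS (subsingleton_ext_of_module_projective P Y hP hi) h⟩

lemma IsSyzygyStep.subsingleton_ext_right_iff (h : IsSyzygyStep A B)
    (hX : semiGorensteinProjective T X) {i : ℕ} (hi : 0 < i) :
    Subsingleton (Ext X B i) ↔ Subsingleton (Ext X A (i + 1)) := by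
  obtain ⟨P, f, g, w, hS, -, hP⟩ := h
  exact ⟨fun h => subsingleton_ext_X₁_right hS h (hX.2 P hP _ i.succ_pos),
    fun h => subsingleton_ext_X₃_right hS (hX.2 P hP _ hi) h⟩

lemma IsSyzygy.subsingleton_ext_left_iff {m : ℕ} (h : IsSyzygy m A B) (Y : ModuleCat.{u} T)
    {i : ℕ} (hi : 0 < i) : Subsingleton (Ext A Y i) ↔ Subsingleton (Ext B Y (i + m)) := by
  induction m generalizing B with
  | zero => obtain rfl : A = B := h; rfl
  | succ m ih =>
    obtain ⟨M, hM, hMB⟩ := h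
    rw [ih hM, hMB.subsingleton_ext_left_iff Y (by omega), add_assoc]

lemma IsSyzygy.subsingleton_ext_right_iff {m : ℕ} (h : IsSyzygy m A B)
    (hX : semiGorensteinProjective T X) {i : ℕ} (hi : 0 < i) :
    Subsingleton (Ext X B i) ↔ Subsingleton (Ext X A (i + m)) := by
  induction m generalizing B i with
  | zero => obtain rfl : A = B := h; rfl
  | succ m ih =>
    obtain ⟨M, hM, hMB⟩ := h
    rw [hMB.subsingleton_ext_right_iff hX hi, ih hM (by omega), add_assoc, add_comm 1 m]

lemma IsSyzygyStep.finite_right (h : IsSyzygyStep A B) : Module.Finite T B := by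
  obtain ⟨P, f, g, w, hS, hP, -⟩ := h
  exact Module.Finite.of_surjective g.hom hS.moduleCat_surjective_g

lemma IsSyzygyStep.finite_left [IsNoetherianRing T] (h : IsSyzygyStep A B) :
    Module.Finite T A := by
  obtain ⟨P, f, g, w, hS, hP, -⟩ := h
  exact Module.Finite.of_injective f.hom hS.moduleCat_injective_f

lemma IsSyzygy.finite_left [IsNoetherianRing T] {m : ℕ} (h : IsSyzygy m A B)
    (hB : Module.Finite T B) : Module.Finite T A := by
  induction m generalizing B with
  | zero => obtain rfl : A = B := h; exact hB
  | succ m ih =>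
    obtain ⟨M, hM, hMB⟩ := h
    exact ih hM hMB.finite_left

/-- The short exact sequence of the kernel of a surjection. -/
lemma shortExact_subtype_ker {P B : ModuleCat.{u} T} (g : P ⟶ B) (hg : Function.Surjective g) :
    (ShortComplex.mk (ModuleCat.ofHom (LinearMap.ker g.hom).subtype) g
      (by ext x; exact x.2)).ShortExact where
  exact := by
    rw [ShortComplex.moduleCat_exact_iff]
    exact fun x hx => ⟨⟨x, hx⟩, rfl⟩
  mono_f := (ModuleCat.mono_iff_injective _).2 Subtype.val_injective
  epi_g := (ModuleCat.epi_iff_surjective _).2 hg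

lemma exists_isSyzygyStep (B : ModuleCat.{u} T) (hB : Module.Finite T B) :
    ∃ A, IsSyzygyStep A B := by
  obtain ⟨r, g, hg⟩ := Module.Finite.exists_fin' T B
  exact ⟨_, ModuleCat.of T (Fin r → T), _, ModuleCat.ofHom g, _,
    shortExact_subtype_ker (ModuleCat.ofHom g) hg, inferInstanceAs (Module.Finite T (Fin r → T)),
    inferInstanceAs (Module.Projective T (Fin r → T))⟩

lemma exists_isSyzygy [IsNoetherianRing T] (m : ℕ) (B : ModuleCat.{u} T)
    (hB : Module.Finite T B) : ∃ A, IsSyzygy m A B := by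
  induction m generalizing B with
  | zero => exact ⟨B, rfl⟩
  | succ m ih =>
    obtain ⟨M, hM⟩ := exists_isSyzygyStep B hB
    obtain ⟨A, hA⟩ := ih M hM.finite_left
    exact ⟨A, M, hA, hM⟩

lemma IsSyzygyStep.semiGorensteinProjective_left [IsNoetherianRing T] (h : IsSyzygyStep A B)
    (hB : semiGorensteinProjective T B) : semiGorensteinProjective T A :=
  ⟨h.finite_left, fun Q hQ i hi =>
    (h.subsingleton_ext_left_iff Q hi).2 (hB.2 Q hQ _ i.succ_pos)⟩

/-- Maps from a finitely generated submodule to a projective module extend as soon as maps to the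
ring do. -/
lemma exists_extension_of_projective {K F Q : Type*} [AddCommGroup K] [Module T K]
    [AddCommGroup F] [Module T F] [AddCommGroup Q] [Module T Q] [Module.Finite T K]
    [Module.Projective T Q] (ι : K →ₗ[T] F)
    (h : ∀ φ : K →ₗ[T] T, ∃ ψ : F →ₗ[T] T, ψ ∘ₗ ι = φ) (f : K →ₗ[T] Q) :
    ∃ g : F →ₗ[T] Q, g ∘ₗ ι = f := by
  classical
  obtain ⟨s, hs⟩ := Module.Projective.out (R := T) (P := Q)
  obtain ⟨t, ht⟩ := Module.Finite.fg_top (R := T) (M := K)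
  -- `s` embeds Q in the free module on its elements. As K is finitely generated, only the finitely
  -- many coordinates in `U` occur on the image of `f`, so Q itself need not be finitely generated.
  let U : Finset Q := t.biUnion fun k => (s (f k)).support
  have hU : ∀ k : K, (s (f k)).support ⊆ U := by
    intro k
    have : (⊤ : Submodule T K) ≤ (Finsupp.supported T T (U : Set Q)).comap (s ∘ₗ f) := by
      rw [← ht, Submodule.span_le]
      intro k hk
      rw [SetLike.mem_coe, Submodule.mem_comap, Finsupp.mem_supported]
      exact_mod_cast Finset.subset_biUnion_of_mem (fun k => (s (f k)).support) hk
    have hk := this (Submodule.mem_top (x := k))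
    rw [Submodule.mem_comap, Finsupp.mem_supported] at hk
    exact_mod_cast hk
  choose ψ hψ using fun q : Q => h (Finsupp.lapply q ∘ₗ s ∘ₗ f)
  refine ⟨Finsupp.linearCombination T _root_.id ∘ₗ ∑ q ∈ U, Finsupp.lsingle q ∘ₗ ψ q, ?_⟩
  ext k
  have hk : ∑ q ∈ U, Finsupp.single q (ψ q (ι k)) = s (f k) := by
    rw [← Finsupp.sum_single (s (f k)), Finsupp.sum_of_support_subset _ (hU k) _ (by simp)]
    exact Finset.sum_congr rfl fun q _ =>
      congrArg (Finsupp.single q) (LinearMap.congr_fun (hψ q) k)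
  simp only [LinearMap.comp_apply, LinearMap.sum_apply, Finsupp.lsingle_apply, hk]
  exact hs (f k)

/-- In degree 1 this is the extension of maps from a finitely generated syzygy; higher degrees
reduce to it by dimension shifting. -/
lemma semiGorensteinProjective_of_subsingleton_ext_self [IsNoetherianRing T]
    {M : ModuleCat.{u} T} (hM : Module.Finite T M)
    (h : ∀ i : ℕ, 0 < i → Subsingleton (Ext M (ModuleCat.of T T) i)) :
    semiGorensteinProjective T M := by
  refine ⟨hM, fun Q hQ i hi => ?_⟩
  obtain ⟨j, rfl⟩ := Nat.exists_eq_succ_of_ne_zero hi.ne'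
  induction j generalizing M with
  | zero =>
    obtain ⟨K, hK⟩ := exists_isSyzygyStep M hM
    have := hK.finite_left
    obtain ⟨P, f, g, w, hS, -, hP⟩ := hK
    refine subsingleton_ext_one_of_exists_extension hS
      (subsingleton_ext_of_module_projective P Q hP one_pos) fun φ => ?_
    obtain ⟨ψ, hψ⟩ := exists_extension_of_projective f.hom (fun φ => by
      obtain ⟨ψ, hψ⟩ := exists_extension_of_subsingleton_ext hS (h 1 one_pos) (ModuleCat.ofHom φ)
      exact ⟨ψ.hom, by rw [← ModuleCat.hom_comp, hψ]; rfl⟩) φ.hom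
    exact ⟨ModuleCat.ofHom ψ, ModuleCat.hom_ext hψ⟩
  | succ j ih =>
    obtain ⟨K, hK⟩ := exists_isSyzygyStep M hM
    exact (hK.subsingleton_ext_left_iff Q j.succ_pos).1 (ih hK.finite_left
      (fun i hi => (hK.subsingleton_ext_left_iff _ hi).2 (h _ i.succ_pos)) j.succ_pos)

/-- Ext^i(A, T) shifts to Ext^{i+m}(B, T), which lies beyond the injective dimension of T. -/
lemma IsSyzygy.semiGorensteinProjective_of_le [IsNoetherianRing T] {d m : ℕ}
    (hd : HasInjectiveDimensionLE (ModuleCat.of T T) d) (hm : d ≤ m) (h : IsSyzygy m A B)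
    (hB : Module.Finite T B) : semiGorensteinProjective T A :=
  semiGorensteinProjective_of_subsingleton_ext_self (h.finite_left hB) fun i hi =>
    (h.subsingleton_ext_left_iff _ hi).2
      (HasInjectiveDimensionLT.subsingleton _ (d + 1) _ (by omega) _)

end Syzygies

/-! ### The duality Hom(-, Λ) and the construction of cosyzygies -/

section Duality

variable {Λ : Type u} [Ring Λ]

/-- A ring is isomorphic to its opposite as a right module. -/
def opLinearEquivSelf (Λ : Type u) [Ring Λ] : Λ ≃ₗ[Λᵐᵒᵖ] Λᵐᵒᵖ where
  toFun := MulOpposite.op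
  invFun := MulOpposite.unop
  map_add' _ _ := rfl
  map_smul' _ _ := rfl
  left_inv _ := rfl
  right_inv _ := rfl

instance projective_self_op : Module.Projective Λᵐᵒᵖ Λ :=
  Module.Projective.of_equiv (opLinearEquivSelf Λ).symm

instance finite_self_op : Module.Finite Λᵐᵒᵖ Λ :=
  Module.Finite.equiv (opLinearEquivSelf Λ).symm

lemma projective_pi_op (s : ℕ) : Module.Projective Λᵐᵒᵖ (Fin s → Λ) :=
  Module.Projective.of_equiv (LinearEquiv.piCongrRight fun _ => (opLinearEquivSelf Λ).symm)

lemma pi_apply_eq_sum_single {T : Type*} [Semiring T] {M : Type*} [AddCommMonoid M] [Module T M]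
    {r : ℕ} (f : (Fin r → T) →ₗ[T] M) (v : Fin r → T) : f v = ∑ i, v i • f (Pi.single i 1) := by
  conv_lhs => rw [← Finset.univ_sum_single v, map_sum]
  refine Finset.sum_congr rfl fun i _ => ?_
  rw [← map_smul, ← Pi.single_smul, smul_eq_mul, mul_one]

/-- The contravariant action of `Hom(-, Λ)` on maps of right modules. -/
def dualMap {M N : Type u} [AddCommGroup M] [Module Λᵐᵒᵖ M] [AddCommGroup N] [Module Λᵐᵒᵖ N]
    (f : M →ₗ[Λᵐᵒᵖ] N) : (N →ₗ[Λᵐᵒᵖ] Λ) →ₗ[Λ] (M →ₗ[Λᵐᵒᵖ] Λ) where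
  toFun φ := φ ∘ₗ f
  map_add' _ _ := rfl
  map_smul' _ _ := rfl

/-- The left module `Hom(M, Λ)`. -/
abbrev dual (M : ModR Λ) : ModuleCat.{u} Λ := ModuleCat.of Λ (M →ₗ[Λᵐᵒᵖ] Λ)

lemma shortExact_dual {S : ShortComplex (ModR Λ)} (hS : S.ShortExact)
    (h : Subsingleton (Ext S.X₃ (ModuleCat.of Λᵐᵒᵖ Λ) 1)) :
    (ShortComplex.mk (X₁ := dual S.X₃) (X₂ := dual S.X₂) (X₃ := dual S.X₁)
      (ModuleCat.ofHom (dualMap S.g.hom)) (ModuleCat.ofHom (dualMap S.f.hom))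
      (by
        ext φ : 2
        refine LinearMap.ext fun x => ?_
        exact (congrArg φ (S.moduleCat_zero_apply x)).trans (map_zero φ))).ShortExact where
  exact := by
    rw [ShortComplex.moduleCat_exact_iff]
    intro φ hφ
    have := hS.epi_g
    have hz : S.f ≫ ModuleCat.ofHom (X := S.X₂) (Y := Λ) φ = 0 := ModuleCat.hom_ext hφ
    exact ⟨(hS.exact.desc (ModuleCat.ofHom φ) hz).hom,
      congrArg ModuleCat.Hom.hom (hS.exact.g_desc (ModuleCat.ofHom φ) hz)⟩
  mono_f := by
    rw [ModuleCat.mono_iff_injective]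
    intro φ ψ hφψ
    refine LinearMap.ext fun x => ?_
    obtain ⟨y, rfl⟩ := hS.moduleCat_surjective_g x
    exact LinearMap.congr_fun hφψ y
  epi_g := by
    rw [ModuleCat.epi_iff_surjective]
    intro φ
    obtain ⟨ψ, hψ⟩ := exists_extension_of_subsingleton_ext hS h (ModuleCat.ofHom φ)
    exact ⟨ψ.hom, congrArg ModuleCat.Hom.hom hψ⟩

lemma projective_dual_pi (r : ℕ) :
    Module.Projective Λ ((Fin r → Λᵐᵒᵖ) →ₗ[Λᵐᵒᵖ] Λ) :=
  Module.Projective.of_equiv ((Pi.basisFun Λᵐᵒᵖ (Fin r)).constr Λ)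

lemma finite_dual_pi (r : ℕ) : Module.Finite Λ ((Fin r → Λᵐᵒᵖ) →ₗ[Λᵐᵒᵖ] Λ) :=
  Module.Finite.equiv ((Pi.basisFun Λᵐᵒᵖ (Fin r)).constr Λ)

/-- A finite free right module is reflexive. -/
lemma exists_eq_eval_of_pi {r : ℕ} (ψ : ((Fin r → Λᵐᵒᵖ) →ₗ[Λᵐᵒᵖ] Λ) →ₗ[Λ] Λ) :
    ∃ q : Fin r → Λᵐᵒᵖ, ∀ φ, ψ φ = φ q := by
  let c : Fin r → ((Fin r → Λᵐᵒᵖ) →ₗ[Λᵐᵒᵖ] Λ) := fun i =>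
    (opLinearEquivSelf Λ).symm.toLinearMap ∘ₗ LinearMap.proj i
  refine ⟨fun i => MulOpposite.op (ψ (c i)), fun φ => ?_⟩
  have hφ : φ = ∑ i, φ (Pi.single i 1) • c i := by
    refine LinearMap.ext fun v => ?_
    rw [pi_apply_eq_sum_single φ v, LinearMap.sum_apply]
    rfl
  conv_lhs => rw [hφ]
  rw [map_sum, pi_apply_eq_sum_single φ]
  exact Finset.sum_congr rfl fun i _ => map_smul ψ _ _

/-- Elements of a finite free right module are separated by linear forms. -/
lemma eq_of_forall_pi {r : ℕ} {p q : Fin r → Λᵐᵒᵖ}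
    (h : ∀ φ : (Fin r → Λᵐᵒᵖ) →ₗ[Λᵐᵒᵖ] Λ, φ p = φ q) : p = q :=
  funext fun i => (opLinearEquivSelf Λ).symm.injective
    (h ((opLinearEquivSelf Λ).symm.toLinearMap ∘ₗ LinearMap.proj i))

/-- A finitely generated module has a finite free presentation whose kernel is a syzygy. -/
lemma exists_shortExact_pi (M : ModR Λ) (hM : Module.Finite Λᵐᵒᵖ M) :
    ∃ (r : ℕ) (K : ModR Λ) (f : K ⟶ ModuleCat.of Λᵐᵒᵖ (Fin r → Λᵐᵒᵖ))
      (g : ModuleCat.of Λᵐᵒᵖ (Fin r → Λᵐᵒᵖ) ⟶ M) (w : f ≫ g = 0),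
      (ShortComplex.mk f g w).ShortExact ∧ IsSyzygyStep K M := by
  obtain ⟨r, g, hg⟩ := Module.Finite.exists_fin' Λᵐᵒᵖ M
  have hS := shortExact_subtype_ker (ModuleCat.ofHom g) hg
  exact ⟨r, _, _, ModuleCat.ofHom g, _, hS, _, _, _, _, hS,
    inferInstanceAs (Module.Finite Λᵐᵒᵖ (Fin r → Λᵐᵒᵖ)),
    inferInstanceAs (Module.Projective Λᵐᵒᵖ (Fin r → Λᵐᵒᵖ))⟩

lemma semiGorensteinProjective.subsingleton_ext_one_self {M : ModR Λ}
    (hM : semiGorensteinProjective Λᵐᵒᵖ M) : Subsingleton (Ext M (ModuleCat.of Λᵐᵒᵖ Λ) 1) :=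
  hM.2 _ projective_self_op 1 one_pos

/-- Dualizing 0 → K → F → M → 0 makes M* a first syzygy of K*, so M* is a syzygy of arbitrarily high
order; Ext is then pushed beyond the left injective dimension of Λ. -/
lemma subsingleton_ext_dual [IsNoetherianRing Λᵐᵒᵖ] {d : ℕ} (hd : HasInjectiveDimensionLE (ModuleCat.of Λ Λ) d)
    {M : ModR Λ} (hM : semiGorensteinProjective Λᵐᵒᵖ M) {i : ℕ} (hi : 0 < i) :
    Subsingleton (Ext (dual M) (ModuleCat.of Λ Λ) i) := by
  suffices ∀ (k i : ℕ) (M : ModR Λ), semiGorensteinProjective Λᵐᵒᵖ M → 0 < i → d + 1 ≤ i + k →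
      Subsingleton (Ext (dual M) (ModuleCat.of Λ Λ) i) from
    this (d + 1) i M hM hi (by omega)
  intro k
  induction k with
  | zero => exact fun i M _ _ h => HasInjectiveDimensionLT.subsingleton _ (d + 1) _ h _
  | succ k ih =>
    intro i M hM hi h
    obtain ⟨r, K, f, g, w, hS, hK⟩ := exists_shortExact_pi M hM.1
    exact subsingleton_ext_X₁_left (shortExact_dual hS hM.subsingleton_ext_one_self)
      (subsingleton_ext_of_module_projective _ _ (projective_dual_pi r) hi)
      (ih (i + 1) K (hK.semiGorensteinProjective_left hM) i.succ_pos (by omega))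

/-- The canonical map `M ⟶ M**` is surjective. -/
lemma exists_eq_eval [IsNoetherianRing Λᵐᵒᵖ] {d : ℕ} (hd : HasInjectiveDimensionLE (ModuleCat.of Λ Λ) d)
    {M : ModR Λ} (hM : semiGorensteinProjective Λᵐᵒᵖ M) (ψ : (M →ₗ[Λᵐᵒᵖ] Λ) →ₗ[Λ] Λ) :
    ∃ m : M, ∀ φ, ψ φ = φ m := by
  obtain ⟨r, K, f, g, w, hS, hK⟩ := exists_shortExact_pi M hM.1
  -- Ext^1(K*, Λ) = 0 extends ψ from M* to F*. Since F is reflexive, the extension is evaluation at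
  -- some q, and ψ is evaluation at the image of q.
  obtain ⟨ψ', hψ'⟩ := exists_extension_of_subsingleton_ext
    (shortExact_dual hS hM.subsingleton_ext_one_self)
    (subsingleton_ext_dual hd (hK.semiGorensteinProjective_left hM) one_pos)
    (ModuleCat.ofHom ψ)
  obtain ⟨q, hq⟩ := exists_eq_eval_of_pi ψ'.hom
  exact ⟨g q, fun φ => (LinearMap.congr_fun (congrArg ModuleCat.Hom.hom hψ') φ).symm.trans
    (hq (φ ∘ₗ g.hom))⟩

/-- The canonical map `M ⟶ M**` is injective. -/
lemma eq_zero_of_forall_dual [IsNoetherianRing Λᵐᵒᵖ] {d : ℕ}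
    (hd : HasInjectiveDimensionLE (ModuleCat.of Λ Λ) d)
    {M : ModR Λ} (hM : semiGorensteinProjective Λᵐᵒᵖ M) {x : M}
    (hx : ∀ φ : M →ₗ[Λᵐᵒᵖ] Λ, φ x = 0) : x = 0 := by
  obtain ⟨r, K, f, g, w, hS, hK⟩ := exists_shortExact_pi M hM.1
  obtain ⟨p, rfl⟩ := hS.moduleCat_surjective_g x
  have hD := shortExact_dual hS hM.subsingleton_ext_one_self
  let ev : dual (ModuleCat.of Λᵐᵒᵖ (Fin r → Λᵐᵒᵖ)) ⟶ ModuleCat.of Λ Λ :=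
    ModuleCat.ofHom
      { toFun := fun φ => φ p
        map_add' := fun _ _ => rfl
        map_smul' := fun _ _ => rfl }
  have := hD.epi_g
  -- Evaluation at p kills M*, so it descends to K*, where it is evaluation at some k by
  -- `exists_eq_eval`. Hence p comes from K and maps to 0 in M.
  have hz : ModuleCat.ofHom (dualMap g.hom) ≫ ev = 0 := ModuleCat.hom_ext (LinearMap.ext hx)
  obtain ⟨k, hk⟩ := exists_eq_eval hd (hK.semiGorensteinProjective_left hM)
    (hD.exact.desc ev hz).hom
  have hp : p = f k := eq_of_forall_pi fun φ =>
    (LinearMap.congr_fun (congrArg ModuleCat.Hom.hom (hD.exact.g_desc ev hz)) φ).symm.trans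
      (hk (φ ∘ₗ f.hom))
  rw [hp]
  exact (ShortComplex.mk f g w).moduleCat_zero_apply k

lemma finite_dual [IsNoetherianRing Λ] (M : ModR Λ) (hM : Module.Finite Λᵐᵒᵖ M) :
    Module.Finite Λ (M →ₗ[Λᵐᵒᵖ] Λ) := by
  obtain ⟨r, g, hg⟩ := Module.Finite.exists_fin' Λᵐᵒᵖ M
  have := finite_dual_pi (Λ := Λ) r
  exact Module.Finite.of_injective (dualMap g) fun φ ψ h =>
    (LinearMap.cancel_right hg).1 h

/-- Over an Iwanaga-Gorenstein noetherian ring every semi-Gorenstein projective module has a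
semi-Gorenstein projective cosyzygy. -/
lemma exists_cosyzygy [IsNoetherianRing Λᵐᵒᵖ] [IsNoetherianRing Λ] {d : ℕ}
    (hd : HasInjectiveDimensionLE (ModuleCat.of Λ Λ) d)
    {M : ModR Λ} (hM : semiGorensteinProjective Λᵐᵒᵖ M) :
    ∃ B : ModR Λ, semiGorensteinProjective Λᵐᵒᵖ B ∧ IsSyzygyStep M B := by
  have := finite_dual M hM.1
  obtain ⟨s, c, hc⟩ := Module.Finite.exists_fin' Λ (M →ₗ[Λᵐᵒᵖ] Λ)
  -- The components of `f` generate M*. So `f` is injective because M is torsionless, and every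
  -- linear form on M factors through `f`, which gives Ext^1(B, Λ) = 0 for the cokernel B.
  let f : M →ₗ[Λᵐᵒᵖ] (Fin s → Λ) := LinearMap.pi fun i => c (Pi.single i 1)
  have hcf (a : Fin s → Λ) (x : M) : c a x = ∑ i, a i * f x i := by
    conv_lhs => rw [pi_apply_eq_sum_single c a, LinearMap.sum_apply]
    rfl
  have hf : Function.Injective f := by
    rw [← LinearMap.ker_eq_bot, LinearMap.ker_eq_bot']
    refine fun x hx => eq_zero_of_forall_dual hd hM fun φ => ?_
    obtain ⟨a, rfl⟩ := hc φ
    rw [hcf, hx]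
    simp
  have hS : (ShortComplex.mk (ModuleCat.ofHom f) (ModuleCat.ofHom (LinearMap.range f).mkQ)
      (by ext x : 2; exact (Submodule.Quotient.mk_eq_zero _).2 ⟨x, rfl⟩)).ShortExact :=
    { exact := by
        rw [ShortComplex.moduleCat_exact_iff]
        exact fun x hx => (Submodule.Quotient.mk_eq_zero _).1 hx
      mono_f := (ModuleCat.mono_iff_injective _).2 hf
      epi_g := (ModuleCat.epi_iff_surjective _).2 (Submodule.mkQ_surjective _) }
  have hB : IsSyzygyStep M (ModuleCat.of Λᵐᵒᵖ ((Fin s → Λ) ⧸ LinearMap.range f)) :=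
    ⟨_, _, _, _, hS, inferInstanceAs (Module.Finite Λᵐᵒᵖ (Fin s → Λ)),
      projective_pi_op s⟩
  refine ⟨_, semiGorensteinProjective_of_subsingleton_ext_self hB.finite_right fun i hi => ?_, hB⟩
  obtain ⟨j, rfl⟩ := Nat.exists_eq_succ_of_ne_zero hi.ne'
  rcases j.eq_zero_or_pos with rfl | hj
  · refine subsingleton_ext_one_of_exists_extension hS
      (subsingleton_ext_of_module_projective (ModuleCat.of Λᵐᵒᵖ (Fin s → Λ)) _
        (projective_pi_op s) one_pos) fun φ => ?_
    obtain ⟨a, ha⟩ := hc ((opLinearEquivSelf Λ).symm.toLinearMap ∘ₗ φ.hom)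
    refine ⟨ModuleCat.ofHom ((opLinearEquivSelf Λ).toLinearMap ∘ₗ
      ∑ i, a i • LinearMap.proj (R := Λᵐᵒᵖ) (φ := fun _ => Λ) i), ?_⟩
    ext x : 2
    apply (opLinearEquivSelf Λ).symm.injective
    have hx := (hcf a x).symm.trans (LinearMap.congr_fun ha x)
    simpa [LinearMap.sum_apply] using hx
  · exact (hB.subsingleton_ext_left_iff _ hj).1
      (hM.2 (ModuleCat.of Λᵐᵒᵖ Λᵐᵒᵖ) (inferInstanceAs (Module.Projective Λᵐᵒᵖ Λᵐᵒᵖ)) _ hj)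

end Duality

/-! ### Two-sided sequences by choice -/

section IntChain

lemma exists_int_chain {α : Type*} (r : α → α → Prop) (hs : ∀ a, ∃ b, r a b)
    (hp : ∀ b, ∃ a, r a b) (a : α) : ∃ Z : ℤ → α, Z 0 = a ∧ ∀ j, r (Z j) (Z (j + 1)) := by
  choose s hs using hs
  choose p hp using hp
  refine ⟨fun j => match j with
    | Int.ofNat n => s^[n] a
    | Int.negSucc n => p^[n + 1] a, rfl, fun j => ?_⟩
  match j with
  | Int.ofNat n =>
    change r (s^[n] a) (s^[n + 1] a)
    rw [Function.iterate_succ_apply']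
    exact hs _
  | Int.negSucc 0 => exact hp a
  | Int.negSucc (n + 1) =>
    change r (p^[n + 1 + 1] a) (p^[n + 1] a)
    rw [Function.iterate_succ_apply' p (n + 1)]
    exact hp _

end IntChain

/-! ### Cycles of acyclic complexes, and splicing -/

section Complexes

variable {T : Type u} [Ring T]

lemma epi_toCycles {P : CochainComplex (ModuleCat.{u} T) ℤ} (hP : P.Acyclic) {i j : ℤ}
    (hij : i + 1 = j) : Epi (P.toCycles i j) := by
  subst hij
  rw [ModuleCat.epi_iff_surjective]
  intro x
  have hex := hP (i + 1)
  rw [P.exactAt_iff' i (i + 1) (i + 1 + 1) (by simp) (by simp),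
    ShortComplex.moduleCat_exact_iff] at hex
  obtain ⟨y, hy⟩ := hex (P.iCycles (i + 1) x)
    (congrArg (fun φ => φ.hom x) (P.iCycles_d (i + 1) (i + 1 + 1)))
  refine ⟨y, (ModuleCat.mono_iff_injective (P.iCycles (i + 1))).1 inferInstance ?_⟩
  exact (congrArg (fun φ => φ.hom y) (P.toCycles_i i (i + 1))).trans hy

lemma iCycles_comp_toCycles (P : CochainComplex (ModuleCat.{u} T) ℤ) (i j : ℤ) :
    P.iCycles i ≫ P.toCycles i j = 0 := by
  rw [← cancel_mono (P.iCycles j), Category.assoc, P.toCycles_i, P.iCycles_d, Limits.zero_comp]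

lemma shortExact_cycles {P : CochainComplex (ModuleCat.{u} T) ℤ} (hP : P.Acyclic) (i : ℤ) :
    (ShortComplex.mk (P.iCycles i) (P.toCycles i (i + 1))
      (iCycles_comp_toCycles P i (i + 1))).ShortExact where
  exact := by
    rw [ShortComplex.moduleCat_exact_iff]
    intro x hx
    have hex := hP i
    rw [P.exactAt_iff' (i - 1) i (i + 1) (by simp) (by simp),
      ShortComplex.moduleCat_exact_iff] at hex
    have hd : P.d i (i + 1) x = 0 := by
      have := congrArg (fun φ => φ.hom x) (P.toCycles_i i (i + 1))
      refine this.symm.trans ?_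
      exact (congrArg (P.iCycles (i + 1)).hom hx).trans (map_zero _)
    obtain ⟨y, hy⟩ := hex x hd
    exact ⟨P.toCycles (i - 1) i y, (congrArg (fun φ => φ.hom y) (P.toCycles_i (i - 1) i)).trans hy⟩
  mono_f := inferInstanceAs (Mono (P.iCycles i))
  epi_g := epi_toCycles hP rfl

lemma iCycles_comp_eq_zero {P : CochainComplex (ModuleCat.{u} T) ℤ} (hP : P.Acyclic) {j : ℤ}
    {Q : ModuleCat.{u} T} {g : P.X j ⟶ Q} (hg : P.d (j - 1) j ≫ g = 0) :
    P.iCycles j ≫ g = 0 := by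
  have := epi_toCycles hP (sub_add_cancel j 1)
  rw [← cancel_epi (P.toCycles (j - 1) j), Limits.comp_zero, ← Category.assoc, P.toCycles_i, hg]

lemma exists_toCycles_comp_eq {P : CochainComplex (ModuleCat.{u} T) ℤ} (hP : P.Acyclic) {j : ℤ}
    {Q : ModuleCat.{u} T} {g : P.X j ⟶ Q} (hg : P.iCycles j ≫ g = 0) :
    ∃ h : P.cycles (j + 1) ⟶ Q, P.toCycles j (j + 1) ≫ h = g := by
  have hS := shortExact_cycles hP j
  have := hS.epi_g
  exact ⟨hS.exact.desc g hg, hS.exact.g_desc g hg⟩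

/-- Short exact sequences `0 ⟶ Z j ⟶ P j ⟶ Z (j + 1) ⟶ 0` splice to an acyclic complex. -/
lemma exists_splice (Z P : ℤ → ModuleCat.{u} T) (f : ∀ j, Z j ⟶ P j) (g : ∀ j, P j ⟶ Z (j + 1))
    (w : ∀ j, f j ≫ g j = 0) (hS : ∀ j, (ShortComplex.mk (f j) (g j) (w j)).ShortExact) :
    ∃ K : CochainComplex (ModuleCat.{u} T) ℤ, K.Acyclic ∧ K.X = P ∧
      ∀ j, Nonempty (Z j ≅ K.cycles j) := by
  let K : CochainComplex (ModuleCat.{u} T) ℤ :=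
    CochainComplex.of P (fun j => g j ≫ f (j + 1)) fun j => by
      rw [Category.assoc, ← Category.assoc (f (j + 1)), w, Limits.zero_comp, Limits.comp_zero]
  have hd : ∀ j, K.d j (j + 1) = g j ≫ f (j + 1) := fun j => by
    exact CochainComplex.of_d P (fun j => g j ≫ f (j + 1)) j
  refine ⟨K, fun j => ?_, rfl, fun j => ⟨?_⟩⟩
  · obtain ⟨k, rfl⟩ : ∃ k, j = k + 1 := ⟨j - 1, by ring⟩
    rw [K.exactAt_iff' k (k + 1) (k + 1 + 1) (by simp) (by simp),
      ShortComplex.moduleCat_exact_iff]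
    intro x hx
    have hx' : (f (k + 1 + 1)).hom ((g (k + 1)).hom x) = 0 :=
      (congrArg (fun φ => φ.hom x) (hd (k + 1))).symm.trans hx
    obtain ⟨z, hz⟩ := ((ShortComplex.moduleCat_exact_iff _).1 (hS (k + 1)).exact) x
      ((hS (k + 1 + 1)).moduleCat_injective_f (hx'.trans (map_zero _).symm))
    obtain ⟨y, hy⟩ := (hS k).moduleCat_surjective_g z
    exact ⟨y, ((congrArg (fun φ => φ.hom y) (hd k)).trans (congrArg (f (k + 1)).hom hy)).trans hz⟩
  · have := (hS j).mono_f
    have := (hS (j + 1)).mono_f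
    -- Composing `g j` with the monomorphism `f (j + 1)` does not change its kernel Z j.
    exact Limits.IsLimit.conePointUniqueUpToIso
      (Limits.isKernelCompMono (hS j).fIsKernel (f (j + 1)) (hd j))
      (K.cyclesIsKernel j (j + 1) (by simp))

end Complexes

/-! ### Gorenstein projectives over a Gorenstein ring -/

section Gorenstein

variable {Λ : Type u} [Ring Λ]

lemma IsAcyclicFGProj.isSyzygyStep {P : CochainComplex (ModR Λ) ℤ} (hP : IsAcyclicFGProj P)
    (j : ℤ) : IsSyzygyStep (P.cycles j) (P.cycles (j + 1)) :=
  ⟨_, _, _, _, shortExact_cycles hP.acyclic j, hP.finite j, hP.projective j⟩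

lemma IsAcyclicFGProj.isSyzygy {P : CochainComplex (ModR Λ) ℤ} (hP : IsAcyclicFGProj P)
    (m : ℕ) {j k : ℤ} (hk : k = j + m) : IsSyzygy m (P.cycles j) (P.cycles k) := by
  induction m generalizing k with
  | zero =>
    obtain rfl : k = j := by simpa using hk
    rfl
  | succ m ih =>
    obtain rfl : k = j + m + 1 := by rw [hk]; push_cast; ring
    exact ⟨_, ih rfl, hP.isSyzygyStep _⟩

lemma IsAcyclicFGProj.finite_cycles {P : CochainComplex (ModR Λ) ℤ} (hP : IsAcyclicFGProj P)
    (j : ℤ) : Module.Finite Λᵐᵒᵖ (P.cycles j) := by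
  obtain ⟨k, rfl⟩ : ∃ k, j = k + 1 := ⟨j - 1, by ring⟩
  exact (hP.isSyzygyStep k).finite_right

lemma hasInjectiveDimensionLE_op {d : ℕ} (h : HasInjectiveDimensionLE (ModuleCat.of Λᵐᵒᵖ Λ) d) :
    HasInjectiveDimensionLE (ModuleCat.of Λᵐᵒᵖ Λᵐᵒᵖ) d :=
  hasInjectiveDimensionLT_of_iso (opLinearEquivSelf Λ).toModuleIso _

lemma semiGorensteinProjective.of_iso {T : Type u} [Ring T] {M N : ModuleCat.{u} T} (e : M ≅ N)
    (hN : semiGorensteinProjective T N) : semiGorensteinProjective T M :=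
  have := hN.1
  ⟨Module.Finite.equiv e.toLinearEquiv.symm, fun Q hQ i hi =>
    subsingleton_ext_of_retract_left e.hom e.inv e.hom_inv_id (hN.2 Q hQ i hi)⟩

/-- Z^j is a d-th syzygy of Z^{j+d}. Together with `IsAcyclicFGProj.isTotallyAcyclic`, this makes
every acyclic complex of finitely generated projectives totally acyclic. -/
lemma IsAcyclicFGProj.semiGorensteinProjective_cycles [IsNoetherianRing Λᵐᵒᵖ] {d : ℕ}
    (hd : HasInjectiveDimensionLE (ModuleCat.of Λᵐᵒᵖ Λ) d) {P : CochainComplex (ModR Λ) ℤ}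
    (hP : IsAcyclicFGProj P) (j : ℤ) : semiGorensteinProjective Λᵐᵒᵖ (P.cycles j) :=
  (hP.isSyzygy d rfl).semiGorensteinProjective_of_le (hasInjectiveDimensionLE_op hd) le_rfl
    (hP.finite_cycles _)

lemma exists_iCycles_comp_eq {P : CochainComplex (ModR Λ) ℤ} (hP : P.Acyclic)
    {Q : ModR Λ} (hQ : Module.Projective Λᵐᵒᵖ Q) {j : ℤ}
    (h : semiGorensteinProjective Λᵐᵒᵖ (P.cycles (j + 1))) (φ : P.cycles j ⟶ Q) :
    ∃ g : P.X j ⟶ Q, P.iCycles j ≫ g = φ :=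
  exists_extension_of_subsingleton_ext (shortExact_cycles hP j) (h.2 Q hQ 1 one_pos) φ

/-- A map on P^j killed by the differential factors through Z^{j+1}, and extends from there to
P^{j+1} because Ext^1(Z^{j+2}, Q) = 0. -/
lemma IsAcyclicFGProj.isTotallyAcyclic {P : CochainComplex (ModR Λ) ℤ} (hP : IsAcyclicFGProj P)
    (h : ∀ j, semiGorensteinProjective Λᵐᵒᵖ (P.cycles j)) : IsTotallyAcyclic P where
  toIsAcyclicFGProj := hP
  hom_acyclic Q hQ j g hg := by
    obtain ⟨φ, rfl⟩ := exists_toCycles_comp_eq hP.acyclic (iCycles_comp_eq_zero hP.acyclic hg)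
    obtain ⟨ψ, rfl⟩ := exists_iCycles_comp_eq hP.acyclic hQ (h _) φ
    exact ⟨ψ, by rw [← Category.assoc, P.toCycles_i]⟩

lemma IsAcyclicFGProj.homSegmentAcyclic {P : CochainComplex (ModR Λ) ℤ} (hP : IsAcyclicFGProj P)
    (h : ∀ j, semiGorensteinProjective Λᵐᵒᵖ (P.cycles j)) (a b : ℤ) {Q : ModR Λ}
    (hQ : Module.Projective Λᵐᵒᵖ Q) : HomSegmentAcyclic P a b Q where
  exact_right φ hφ := by
    have := epi_toCycles hP.acyclic (sub_add_cancel b 1)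
    rwa [← cancel_epi (P.toCycles (b - 1) b), Limits.comp_zero]
  exact_middle j haj _ g h₁ h₂ := by
    have hg : P.iCycles j ≫ g = 0 := by
      rcases haj.eq_or_lt with rfl | haj
      · exact h₁ rfl
      · exact iCycles_comp_eq_zero hP.acyclic (h₂ haj)
    obtain ⟨φ, rfl⟩ := exists_toCycles_comp_eq hP.acyclic hg
    refine ⟨fun _ => ⟨φ, rfl⟩, fun _ => ?_⟩
    obtain ⟨ψ, rfl⟩ := exists_iCycles_comp_eq hP.acyclic hQ (h _) φ
    exact ⟨ψ, by rw [← Category.assoc, P.toCycles_i]⟩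
  exact_left φ := exists_iCycles_comp_eq hP.acyclic hQ (h _) φ

/-- Over an Iwanaga-Gorenstein noetherian ring every semi-Gorenstein projective module is a module
of cycles of an acyclic complex of finitely generated projective modules. -/
lemma exists_isAcyclicFGProj [IsNoetherianRing Λ] [IsNoetherianRing Λᵐᵒᵖ] {d : ℕ}
    (hd : HasInjectiveDimensionLE (ModuleCat.of Λ Λ) d) {M : ModR Λ}
    (hM : semiGorensteinProjective Λᵐᵒᵖ M) :
    ∃ P : CochainComplex (ModR Λ) ℤ, IsAcyclicFGProj P ∧ Nonempty (M ≅ P.cycles 0) := by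
  obtain ⟨Z, hZ₀, hZ⟩ := exists_int_chain
    (fun A B : {A : ModR Λ // semiGorensteinProjective Λᵐᵒᵖ A} => IsSyzygyStep A.1 B.1)
    (fun A => by
      obtain ⟨B, hB, hAB⟩ := exists_cosyzygy hd A.2
      exact ⟨⟨B, hB⟩, hAB⟩)
    (fun B => by
      obtain ⟨A, hA⟩ := exists_isSyzygyStep B.1 B.2.1
      exact ⟨⟨A, hA.semiGorensteinProjective_left B.2⟩, hA⟩) ⟨M, hM⟩
  choose P f g w hS hfin hproj using hZ
  obtain ⟨K, hK, rfl, hKZ⟩ := exists_splice (fun j => (Z j).1) P f g w hS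
  exact ⟨K, ⟨hK, hfin, hproj⟩, by simpa [hZ₀] using hKZ 0⟩

/-- The right injective dimension controls the cycles of a given complex; the left one gives the
cosyzygies needed to build a complex. -/
lemma Gprj_eq_semiGorensteinProjective [IsNoetherianRing Λ] [IsNoetherianRing Λᵐᵒᵖ]
    (hG : IsIwanagaGorenstein Λ) : Gprj Λ = semiGorensteinProjective Λᵐᵒᵖ := by
  obtain ⟨⟨d, hd⟩, ⟨d', hd'⟩⟩ := hG
  ext M
  constructor
  · rintro ⟨P, hP, j, ⟨e⟩⟩
    exact (hP.toIsAcyclicFGProj.semiGorensteinProjective_cycles hd j).of_iso e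
  · intro hM
    obtain ⟨P, hP, e⟩ := exists_isAcyclicFGProj hd' hM
    exact ⟨P, hP.isTotallyAcyclic (hP.semiGorensteinProjective_cycles hd), 0, e⟩

end Gorenstein

/-! ### Artin algebras are noetherian on both sides -/

section Artin

variable {R : Type*} [CommRing R] {Λ : Type u} [Ring Λ] [Algebra R Λ]

lemma IsArtinAlgebra.isNoetherianRing (h : IsArtinAlgebra R Λ) : IsNoetherianRing Λ :=
  have := h.1
  have := h.2
  isNoetherian_of_tower R inferInstance

lemma IsArtinAlgebra.isNoetherianRing_op (h : IsArtinAlgebra R Λ) : IsNoetherianRing Λᵐᵒᵖ :=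
  have := h.1
  have := h.2
  have : Module.Finite R Λᵐᵒᵖ := Module.Finite.equiv (MulOpposite.opLinearEquiv R)
  isNoetherian_of_tower R inferInstance

end Artin

/-! ### Gorenstein projective approximations -/

section Approximation

variable {T : Type u} [Ring T]

lemma shortExact_inl_snd (E P : ModuleCat.{u} T) :
    (ShortComplex.mk (X₂ := ModuleCat.of T (E × P)) (ModuleCat.ofHom (LinearMap.inl T E P))
      (ModuleCat.ofHom (LinearMap.snd T E P)) rfl).ShortExact where
  exact := by
    rw [ShortComplex.moduleCat_exact_iff]
    exact fun x hx => ⟨x.1, Prod.ext rfl (Eq.symm hx)⟩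
  mono_f := (ModuleCat.mono_iff_injective _).2 LinearMap.inl_injective
  epi_g := (ModuleCat.epi_iff_surjective _).2 LinearMap.snd_surjective

lemma semiGorensteinProjective.prod {E P : ModuleCat.{u} T} (hE : semiGorensteinProjective T E)
    (hP : Module.Finite T P) (hP' : Module.Projective T P) :
    semiGorensteinProjective T (ModuleCat.of T (E × P)) :=
  have := hE.1
  ⟨inferInstanceAs (Module.Finite T (E × P)), fun Q hQ _ hi =>
    subsingleton_ext_X₂_left (shortExact_inl_snd E P) (hE.2 Q hQ _ hi)
      (subsingleton_ext_of_module_projective P Q hP' hi)⟩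

lemma IsSyzygyStep.prod {A E P : ModuleCat.{u} T} (h : IsSyzygyStep A E)
    (hP : Module.Finite T P) (hP' : Module.Projective T P) :
    IsSyzygyStep A (ModuleCat.of T (E × P)) := by
  obtain ⟨Q, a, b, w, hS, hQ, hQ'⟩ := h
  refine ⟨ModuleCat.of T (Q × P), ModuleCat.ofHom (LinearMap.inl T Q P ∘ₗ a.hom),
    ModuleCat.ofHom (b.hom.prodMap LinearMap.id), ?_,
    { exact := ?_, mono_f := ?_, epi_g := ?_ },
    inferInstanceAs (Module.Finite T (Q × P)), inferInstanceAs (Module.Projective T (Q × P))⟩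
  · ext x : 2
    exact Prod.ext ((ShortComplex.mk a b w).moduleCat_zero_apply x) rfl
  · rw [ShortComplex.moduleCat_exact_iff]
    intro x hx
    obtain ⟨y, hy⟩ := (ShortComplex.moduleCat_exact_iff _).1 hS.exact x.1 (congrArg Prod.fst hx)
    exact ⟨y, Prod.ext hy (congrArg Prod.snd hx).symm⟩
  · exact (ModuleCat.mono_iff_injective _).2
      (LinearMap.inl_injective.comp hS.moduleCat_injective_f)
  · exact (ModuleCat.epi_iff_surjective _).2
      (Function.Surjective.prodMap hS.moduleCat_surjective_g Function.surjective_id)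

/-- Right approximations by semi-Gorenstein projective modules, with a prescribed syzygy. -/
lemma IsSyzygy.exists_approximation [IsNoetherianRing T]
    (hc : ∀ A : ModuleCat.{u} T, semiGorensteinProjective T A →
      ∃ B, semiGorensteinProjective T B ∧ IsSyzygyStep A B)
    {m : ℕ} {W B : ModuleCat.{u} T} (h : IsSyzygy m W B) (hW : semiGorensteinProjective T W) :
    ∃ G, semiGorensteinProjective T G ∧ IsSyzygy m W G ∧ ∃ φ : G ⟶ B,
      ∀ X, semiGorensteinProjective T X → ∀ x : X ⟶ B, ∃ y : X ⟶ G, y ≫ φ = x := by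
  induction m generalizing B with
  | zero =>
    obtain rfl : W = B := h
    exact ⟨W, hW, rfl, 𝟙 W, fun X _ x => ⟨x, Category.comp_id x⟩⟩
  | succ m ih =>
    obtain ⟨M, hM, P, f, g, w, hS, hP, hP'⟩ := h
    obtain ⟨G, hG, hWG, φ, hφ⟩ := ih hM
    -- With M the syzygy of B inside P and G → M its approximation, the approximation of B is E ⊕ P
    -- → B for a cosyzygy E of G. The summand P makes it possible to lift maps and leaves G as a
    -- syzygy.
    obtain ⟨E, hE, hGE⟩ := hc G hG
    have hGE' := hGE.prod hP hP'
    obtain ⟨Q, a, b, wab, hab, hQ, hQ'⟩ := hGE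
    have := hS.mono_f
    have := hS.epi_g
    have := hab.epi_g
    obtain ⟨q, hq : a ≫ q = φ ≫ f⟩ :=
      exists_extension_of_subsingleton_ext hab (hE.2 P hP' 1 one_pos) (φ ≫ f)
    have hqz : a ≫ q ≫ g = 0 := by
      rw [← Category.assoc, hq, Category.assoc, w, Limits.comp_zero]
    let e : E ⟶ B := hab.exact.desc (q ≫ g) hqz
    have he : b ≫ e = q ≫ g := hab.exact.g_desc (q ≫ g) hqz
    refine ⟨ModuleCat.of T (E × P), hE.prod hP hP', ⟨G, hWG, hGE'⟩,
      ModuleCat.ofHom (e.hom.coprod g.hom), fun X hX x => ?_⟩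
    obtain ⟨K, hK⟩ := exists_isSyzygyStep X hX.1
    have hK' := hK.semiGorensteinProjective_left hX
    obtain ⟨F, k, p, wkp, hkp, hF, hF'⟩ := hK
    have := hkp.epi_g
    have : Epi g := hS.epi_g
    let t : F ⟶ P := Projective.factorThru (p ≫ x) g
    have ht : t ≫ g = p ≫ x := Projective.factorThru_comp _ _
    have htz : (k ≫ t) ≫ g = 0 := by
      rw [Category.assoc, ht, ← Category.assoc, wkp, Limits.zero_comp]
    let s : K ⟶ M := hS.exact.lift (k ≫ t) htz
    have hs : s ≫ f = k ≫ t := hS.exact.lift_f (k ≫ t) htz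
    obtain ⟨s', hs'⟩ := hφ K hK' s
    obtain ⟨r, hr : k ≫ r = s' ≫ a⟩ :=
      exists_extension_of_subsingleton_ext hkp (hX.2 Q hQ' 1 one_pos) (s' ≫ a)
    have hrz : k ≫ r ≫ b = 0 := by
      rw [← Category.assoc, hr, Category.assoc, wab, Limits.comp_zero]
    -- The lift `t` of `x` and the map `r ≫ q` through Q agree on K, so their difference descends to
    -- X. It becomes the P-component `z` correcting the E-component `v`.
    have htr : k ≫ (t - r ≫ q) = 0 := by
      rw [Preadditive.comp_sub, ← hs, ← Category.assoc k, hr, Category.assoc, hq, ← hs',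
        Category.assoc, sub_self]
    let v : X ⟶ E := hkp.exact.desc (r ≫ b) hrz
    have hv : p ≫ v = r ≫ b := hkp.exact.g_desc (r ≫ b) hrz
    let z : X ⟶ P := hkp.exact.desc (t - r ≫ q) htr
    have hz : p ≫ z = t - r ≫ q := hkp.exact.g_desc (t - r ≫ q) htr
    refine ⟨ModuleCat.ofHom (v.hom.prod z.hom), ?_⟩
    have : Epi p := hkp.epi_g
    have hsum : v ≫ e + z ≫ g = x := by
      rw [← cancel_epi p, Preadditive.comp_add, ← Category.assoc, hv, ← Category.assoc, hz,
        Preadditive.sub_comp, Category.assoc, Category.assoc, he, ht]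
      abel
    exact hsum

lemma exists_isSyzygy_left (hc : ∀ A : ModuleCat.{u} T, semiGorensteinProjective T A →
      ∃ B, semiGorensteinProjective T B ∧ IsSyzygyStep A B)
    (m : ℕ) {A : ModuleCat.{u} T} (hA : semiGorensteinProjective T A) :
    ∃ B, semiGorensteinProjective T B ∧ IsSyzygy m A B := by
  induction m with
  | zero => exact ⟨A, hA, rfl⟩
  | succ m ih =>
    obtain ⟨M, hM, hAM⟩ := ih
    obtain ⟨B, hB, hMB⟩ := hc M hM
    exact ⟨B, hB, M, hAM, hMB⟩

end Approximation

/-! ### Cluster tilting subcategories and the two orthogonals -/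

section ClusterTilting

variable {Λ : Type u} [Ring Λ] {n : ℕ} {𝒞 : ObjectProperty (ModR Λ)}

lemma IsClusterTilting.mem_of_subsingleton_ext (h𝒞 : IsClusterTilting n 𝒞) {X : ModR Λ}
    (hX : Module.Finite Λᵐᵒᵖ X)
    (h : ∀ C, 𝒞 C → ∀ i, 0 < i → i < n → Subsingleton (Ext X C i)) : 𝒞 X := by
  rw [h𝒞.eq_leftPerp]
  exact ⟨hX, h⟩

lemma IsClusterTilting.finite (h𝒞 : IsClusterTilting n 𝒞) {X : ModR Λ} (hX : 𝒞 X) :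
    Module.Finite Λᵐᵒᵖ X := by
  rw [h𝒞.eq_leftPerp] at hX
  exact hX.1

lemma IsClusterTilting.subsingleton_ext (h𝒞 : IsClusterTilting n 𝒞) {X Y : ModR Λ} (hX : 𝒞 X)
    (hY : 𝒞 Y) {i : ℕ} (hi : 0 < i) (hin : i < n) : Subsingleton (Ext X Y i) := by
  rw [h𝒞.eq_leftPerp] at hX
  exact hX.2 Y hY i hi hin

lemma IsClusterTilting.mem_of_projective (h𝒞 : IsClusterTilting n 𝒞) {P : ModR Λ}
    (hP : Module.Finite Λᵐᵒᵖ P) (hP' : Module.Projective Λᵐᵒᵖ P) : 𝒞 P :=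
  h𝒞.mem_of_subsingleton_ext hP fun C _ _ hi _ =>
    subsingleton_ext_of_module_projective P C hP' hi

lemma IsClusterTilting.mem_of_retract (h𝒞 : IsClusterTilting n 𝒞) {X Y : ModR Λ} (i : X ⟶ Y)
    (r : Y ⟶ X) (h : i ≫ r = 𝟙 X) (hY : 𝒞 Y) : 𝒞 X := by
  have := h𝒞.finite hY
  have hr : Function.Surjective r := fun x => ⟨i x, congrArg (fun φ => φ.hom x) h⟩
  exact h𝒞.mem_of_subsingleton_ext (Module.Finite.of_surjective r.hom hr) fun C hC j hj hjn =>
    subsingleton_ext_of_retract_left i r h (h𝒞.subsingleton_ext hY hC hj hjn)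

/-- An `nℤ`-cluster tilting subcategory is closed under `kn`-th syzygies. -/
lemma IsNZClusterTilting.mem_of_isSyzygy [IsNoetherianRing Λᵐᵒᵖ] (h𝒞 : IsNZClusterTilting n 𝒞)
    {k : ℕ} {A B : ModR Λ} (h : IsSyzygy (k * n) A B) (hB : 𝒞 B) : 𝒞 A :=
  h𝒞.mem_of_subsingleton_ext (h.finite_left (h𝒞.finite hB)) fun C hC _ hi hin =>
    (h.subsingleton_ext_left_iff C hi).2 (h𝒞.ext_eq_zero B C hB hC _ fun hdvd =>
      Nat.not_dvd_of_pos_of_lt hi hin ((Nat.dvd_add_left (Dvd.intro_left k rfl)).1 hdvd))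

/-- An `nℤ`-cluster tilting subcategory is closed under semi-Gorenstein projective `kn`-th
cosyzygies. -/
lemma IsNZClusterTilting.mem_of_isSyzygy_of_semiGorensteinProjective [IsNoetherianRing Λᵐᵒᵖ]
    (h𝒞 : IsNZClusterTilting n 𝒞) {k : ℕ} {A B : ModR Λ} (h : IsSyzygy (k * n) A B)
    (hB : semiGorensteinProjective Λᵐᵒᵖ B) (hA : 𝒞 A) : 𝒞 B := by
  refine h𝒞.mem_of_subsingleton_ext hB.1 fun C hC i hi hin => ?_
  -- With W a kn-th syzygy of C, which is again in 𝒞, vanishing of Ext^i(B, C), Ext^{i+kn}(B, W) and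
  -- Ext^i(A, W) is equivalent.
  obtain ⟨W, hW⟩ := exists_isSyzygy (k * n) C (h𝒞.finite hC)
  rw [hW.subsingleton_ext_right_iff hB hi, ← h.subsingleton_ext_left_iff W hi]
  exact h𝒞.subsingleton_ext hA (h𝒞.mem_of_isSyzygy hW hC) hi hin

variable [IsNoetherianRing Λ] [IsNoetherianRing Λᵐᵒᵖ]

/-- A complete resolution with M in degree 0 has Z^{-kn} as kn-th syzygies of M and Z^{kn} as
Gorenstein projective kn-th cosyzygies; 𝒞 is closed under both. -/
lemma nzGprj_eq (hG : IsIwanagaGorenstein Λ) (h𝒞 : IsNZClusterTilting n 𝒞) :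
    nzGprj n 𝒞 = 𝒞 ⊓ semiGorensteinProjective Λᵐᵒᵖ := by
  obtain ⟨⟨d, hd⟩, ⟨d', hd'⟩⟩ := hG
  ext M
  constructor
  · rintro ⟨hM, P, hP, j, ⟨e⟩⟩
    exact ⟨hM, (hP.toIsAcyclicFGProj.semiGorensteinProjective_cycles hd _).of_iso e⟩
  · rintro ⟨hM, hM'⟩
    obtain ⟨P, hP, ⟨e⟩⟩ := exists_isAcyclicFGProj hd' hM'
    have hcyc := hP.semiGorensteinProjective_cycles hd
    have h₀ : 𝒞 (P.cycles 0) := h𝒞.mem_of_retract e.inv e.hom e.inv_hom_id hM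
    refine ⟨hM, P, ⟨hP, fun Q hQ i => hP.homSegmentAcyclic hcyc _ _ hQ, fun i => ?_⟩, 0,
      ⟨by simpa using e⟩⟩
    obtain ⟨k, rfl | rfl⟩ := i.eq_nat_or_neg
    · exact h𝒞.mem_of_isSyzygy_of_semiGorensteinProjective
        (hP.isSyzygy (k * n) (j := 0) (by push_cast; ring)) (hcyc _) h₀
    · exact h𝒞.mem_of_isSyzygy (hP.isSyzygy (k * n) (k := 0) (by push_cast; ring)) h₀

/-- A semi-Gorenstein projective module that is left orthogonal to the semi-Gorenstein projective
modules in `𝒞` is left orthogonal to `𝒞`. -/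
lemma IsNZClusterTilting.mem_of_leftPerp (hG : IsIwanagaGorenstein Λ)
    (h𝒞 : IsNZClusterTilting n 𝒞) {X : ModR Λ}
    (hX : semiGorensteinProjective Λᵐᵒᵖ X)
    (h : ∀ D, 𝒞 D → semiGorensteinProjective Λᵐᵒᵖ D → ∀ i, 0 < i → i < n →
      Subsingleton (Ext X D i)) : 𝒞 X := by
  obtain ⟨⟨d, hd⟩, ⟨d', hd'⟩⟩ := hG
  refine h𝒞.mem_of_subsingleton_ext hX.1 fun C hC i hi hin => ?_
  -- The order `d * n` is at least d, so W is Gorenstein projective, and a multiple of n, so W stays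
  -- in 𝒞.
  obtain ⟨W, hW⟩ := exists_isSyzygy (d * n) C (h𝒞.finite hC)
  have hW' := hW.semiGorensteinProjective_of_le (hasInjectiveDimensionLE_op hd)
    (Nat.le_mul_of_pos_right d (hi.trans hin)) (h𝒞.finite hC)
  obtain ⟨Y, hY, hWY⟩ := exists_isSyzygy_left (fun A hA => exists_cosyzygy hd' hA) (d * n) hW'
  rw [hW.subsingleton_ext_right_iff hX hi, ← hWY.subsingleton_ext_right_iff hX hi]
  exact h Y (h𝒞.mem_of_isSyzygy_of_semiGorensteinProjective hWY hY (h𝒞.mem_of_isSyzygy hW hC)) hY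
    i hi hin

/-- Left approximations of semi-Gorenstein projective modules. -/
lemma IsNZClusterTilting.exists_left_approximation (hn : 1 < n) (hG : IsIwanagaGorenstein Λ)
    (h𝒞 : IsNZClusterTilting n 𝒞) {X : ModR Λ}
    (hX : semiGorensteinProjective Λᵐᵒᵖ X) :
    ∃ (D X' : ModR Λ) (f : X ⟶ D) (g : D ⟶ X') (w : f ≫ g = 0),
      (ShortComplex.mk f g w).ShortExact ∧ 𝒞 D ∧ semiGorensteinProjective Λᵐᵒᵖ D ∧
        semiGorensteinProjective Λᵐᵒᵖ X' ∧ ∀ C, 𝒞 C → Subsingleton (Ext X' C 1) := by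
  obtain ⟨⟨d, hd⟩, ⟨d', hd'⟩⟩ := hG
  obtain ⟨C, c, hC, hc⟩ := h𝒞.covariantlyFinite X hX.1
  obtain ⟨W, hW⟩ := exists_isSyzygy (d * n) C (h𝒞.finite hC)
  have hW' := hW.semiGorensteinProjective_of_le (hasInjectiveDimensionLE_op hd)
    (Nat.le_mul_of_pos_right d (zero_lt_one.trans hn)) (h𝒞.finite hC)
  -- D and C share the dn-th syzygy W, which forces D into 𝒞. As X is Gorenstein projective, its
  -- 𝒞-approximation `c` factors through D, and the resulting `f` is again a 𝒞-approximation.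
  obtain ⟨D, hD, hWD, φ, hφ⟩ := hW.exists_approximation (fun A hA => exists_cosyzygy hd' hA) hW'
  have hD' : 𝒞 D :=
    h𝒞.mem_of_isSyzygy_of_semiGorensteinProjective hWD hD (h𝒞.mem_of_isSyzygy hW hC)
  obtain ⟨f, hf⟩ := hφ X hX c
  have hext : ∀ C', 𝒞 C' → ∀ g : X ⟶ C', ∃ h : D ⟶ C', f ≫ h = g := fun C' hC' g => by
    obtain ⟨h, rfl⟩ := hc C' g hC'
    exact ⟨φ ≫ h, by rw [← Category.assoc, hf]⟩
  -- X embeds in a projective P, which lies in 𝒞; the embedding factors through `f`, so `f` is a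
  -- monomorphism.
  obtain ⟨_, _, P, a, _, _, hab, hP, hP'⟩ := exists_cosyzygy hd' hX
  have : Mono a := hab.mono_f
  obtain ⟨b, hb⟩ := hext P (h𝒞.mem_of_projective hP hP') a
  have : Mono f := mono_of_mono_fac hb
  have hS : (ShortComplex.mk f (Limits.cokernel.π f) (Limits.cokernel.condition f)).ShortExact :=
    { exact := ShortComplex.exact_cokernel f
      mono_f := inferInstance
      epi_g := inferInstance }
  have := hD.1
  have hext₁ : ∀ C', 𝒞 C' → Subsingleton (Ext (Limits.cokernel f) C' 1) := fun C' hC' =>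
    subsingleton_ext_one_of_exists_extension hS (h𝒞.subsingleton_ext hD' hC' one_pos hn)
      (hext C' hC')
  refine ⟨D, Limits.cokernel f, f, Limits.cokernel.π f, _, hS, hD', hD,
    semiGorensteinProjective_of_subsingleton_ext_self
      (Module.Finite.of_surjective _ hS.moduleCat_surjective_g) fun i hi => ?_, hext₁⟩
  obtain ⟨j, rfl⟩ := Nat.exists_eq_succ_of_ne_zero hi.ne'
  have hself : Module.Projective Λᵐᵒᵖ (ModuleCat.of Λᵐᵒᵖ Λᵐᵒᵖ) :=
    inferInstanceAs (Module.Projective Λᵐᵒᵖ Λᵐᵒᵖ)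
  rcases j.eq_zero_or_pos with rfl | hj
  · exact hext₁ _ (h𝒞.mem_of_projective (inferInstanceAs (Module.Finite Λᵐᵒᵖ Λᵐᵒᵖ)) hself)
  · exact subsingleton_ext_X₃_left hS (hX.2 _ hself _ hj) (hD.2 _ hself _ hi)

/-- Dimension shifting along left approximations. -/
lemma IsNZClusterTilting.subsingleton_ext_of_rightPerp (hn : 1 < n) (hG : IsIwanagaGorenstein Λ)
    (h𝒞 : IsNZClusterTilting n 𝒞) {Y : ModR Λ}
    (hY : ∀ D, 𝒞 D → semiGorensteinProjective Λᵐᵒᵖ D → ∀ i, 0 < i → i < n →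
      Subsingleton (Ext D Y i))
    (k : ℕ) {j : ℕ} (hj : 0 < j) (hjk : j + k + 1 = n) {X : ModR Λ}
    (hX : semiGorensteinProjective Λᵐᵒᵖ X)
    (h : ∀ D, 𝒞 D → semiGorensteinProjective Λᵐᵒᵖ D → ∀ i, 0 < i → i ≤ j →
      Subsingleton (Ext X D i)) : Subsingleton (Ext X Y j) := by
  induction k generalizing j X with
  | zero =>
    -- Here j = n - 1, so X is orthogonal to 𝒟 in the full range and lies in 𝒟.
    exact hY X (h𝒞.mem_of_leftPerp hG hX fun D hD hD' i hi hin => h D hD hD' i hi (by omega)) hX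
      j hj (by omega)
  | succ k ih =>
    obtain ⟨E, X', f, g, w, hS, hE, hE', hX', hext⟩ := h𝒞.exists_left_approximation hn hG hX
    -- Ext^j(E, Y) = 0 embeds Ext^j(X, Y) in Ext^{j+1}(X', Y). The cokernel X' is orthogonal to 𝒟 up
    -- to degree j + 1, one more than X.
    refine subsingleton_ext_X₁_left hS (hY E hE hE' j hj (by omega))
      (ih j.succ_pos (by omega) hX' fun D hD hD' i hi hij => ?_)
    obtain ⟨l, rfl⟩ := Nat.exists_eq_succ_of_ne_zero hi.ne'
    rcases l.eq_zero_or_pos with rfl | hl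
    · exact hext D hD
    · exact subsingleton_ext_X₃_left hS (h D hD hD' l hl (by omega))
        (h𝒞.subsingleton_ext hE hD hi (by omega))

/-- A semi-Gorenstein projective module that is right orthogonal to the semi-Gorenstein projective
modules in `𝒞` belongs to `𝒞`. -/
lemma IsNZClusterTilting.mem_of_rightPerp (hG : IsIwanagaGorenstein Λ)
    (h𝒞 : IsNZClusterTilting n 𝒞) {X : ModR Λ}
    (hX : semiGorensteinProjective Λᵐᵒᵖ X)
    (h : ∀ D, 𝒞 D → semiGorensteinProjective Λᵐᵒᵖ D → ∀ i, 0 < i → i < n →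
      Subsingleton (Ext D X i)) : 𝒞 X := by
  rcases le_or_gt n 1 with hn | hn
  · exact h𝒞.mem_of_subsingleton_ext hX.1 fun _ _ _ hi hin => absurd hin (by omega)
  · obtain ⟨D, X', f, g, w, hS, hD, -, hX', hext⟩ := h𝒞.exists_left_approximation hn hG hX
    -- Starting at j = 1 leaves n - 2 shifts to reach degree n - 1. Once Ext^1(X', X) = 0, the
    -- identity of X extends to a retraction of `f`.
    obtain ⟨r, hr⟩ := exists_extension_of_subsingleton_ext hS
      (h𝒞.subsingleton_ext_of_rightPerp hn hG h (n - 2) one_pos (by omega) hX'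
        fun E hE _ i hi hi' => by
          obtain rfl : i = 1 := by omega
          exact hext E hE) (𝟙 X)
    exact h𝒞.mem_of_retract f r hr hD

end ClusterTilting

end NZGor

theorem proposition3p14 {R : Type*} [CommRing R] {Λ : Type u} [Ring Λ] [Algebra R Λ]
    (hΛ : NZGor.IsArtinAlgebra R Λ) (hG : NZGor.IsIwanagaGorenstein Λ)
    (n : ℕ) (hn : 0 < n) (𝒞 : CategoryTheory.ObjectProperty (NZGor.ModR Λ))
    (h𝒞 : NZGor.IsNZClusterTilting n 𝒞) :
    NZGor.nzGprj n 𝒞 = NZGor.leftPerp n (NZGor.nzGprj n 𝒞) ⊓ NZGor.Gprj Λ ∧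
      NZGor.nzGprj n 𝒞 = NZGor.rightPerp n (NZGor.nzGprj n 𝒞) ⊓ NZGor.Gprj Λ := by
  have := hΛ.isNoetherianRing
  have := hΛ.isNoetherianRing_op
  rw [NZGor.nzGprj_eq hG h𝒞, NZGor.Gprj_eq_semiGorensteinProjective hG]
  constructor
  · ext X
    exact ⟨fun hX => ⟨⟨hX.2.1, fun D hD i => h𝒞.subsingleton_ext hX.1 hD.1⟩, hX.2⟩,
      fun hX => ⟨h𝒞.mem_of_leftPerp hG hX.2 fun D hD hD' => hX.1.2 D ⟨hD, hD'⟩, hX.2⟩⟩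
  · ext X
    exact ⟨fun hX => ⟨⟨hX.2.1, fun D hD i => h𝒞.subsingleton_ext hD.1 hX.1⟩, hX.2⟩,
      fun hX => ⟨h𝒞.mem_of_rightPerp hG hX.2 fun D hD hD' => hX.1.2 D ⟨hD, hD'⟩, hX.2⟩⟩
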